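/- Let $D$ be an integral domain with quotient field $K$. A *semistar operation* on $D$ is a map $E\mapsto E^\star$ on the set of nonzero $D$-submodules of $K$ such that, for all nonzero $x\in K$ and all nonzero $D$-submodules $E,F$ of $K$: $(xE)^\star=xE^\star$; $E\subseteq F$ implies $E^\star\subseteq F^\star$; $E\subseteq E^\star$ and $(E^\star)^\star=E^\star$. Its associated finite-type semistar operation is $E^{\star_f}=\bigcup\{F^\star : F\subseteq E,\ F \text{ a nonzero finitely generated } D\text{-submodule of } K\}$. For $A,B\subseteq K$ put $(A:B)=\{x\in K : xB\subseteq A\}$. A nonzero ideal $I$ of $D$ is a *quasi-$\star_f$-ideal* if $I=I^{\star_f}\cap D$; a *quasi-$\star_f$-prime* is a prime quasi-$\star_f$-ideal; a *quasi-$\star_f$-maximal* ideal is a maximal element of the set of proper quasi-$\star_f$-ideals. A nonzero ideal $I$ is *$\star_f$-idempotent* if $I^{\star_f}=(I^2)^{\star_f}$, and *$\star_f$-divisorial* if $I^{\star_f}$ is divisorial in $D^\star$, i.e. $(D^\star:(D^\star:I^{\star_f}))=I^{\star_f}$. An ideal $I$ is a *$\star_f$-product* of ideals $P_1,\dots,P_n$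 ($n\ge 0$, the empty product being $D$) if $I^{\star_f}=(P_1\cdots P_n)^{\star_f}$. $D$ is a *P$\star$MD* if $(F(D:F))^{\star_f}=D^{\star_f}$ for every nonzero finitely generated $D$-submodule $F$ of $K$, and it has *finite $\star_f$-character* if every nonzero element of $D$ lies in only finitely many quasi-$\star_f$-maximal ideals. **Statement.** Let $\star$ be a semistar operation on $D$ such that $D$ is a P$\star$MD with finite $\star_f$-character, and let $I$ be a quasi-$\star_f$-ideal of $D$. Then: 1. $I$ is $\star_f$-idempotent if and only if $I$ is a $\star_f$-product of $\star_f$-idempotent quasi-$\star_f$-prime ideals of $D$. 2. The following statements are equivalent: (a) $I$ is $\star_f$-idempotent and $\star_f$-divisorial. (b) $I$ is a $\star_f$-product of $\star_f$-idempotent quasi-$\star_f$-prime ideals that are not quasi-$\star_f$-maximal. (c) $I$ is a $\star_f$-product of $\star_f$-divisorial $\star_f$-idempotent nonzero prime ideals. (d) $I$ has a unique (up to order) representation as a $\star_f$-product of pairwise incomparable $\star_f$-divisorial $\star_f$-idempotent quasi-$\star_f$-primes. -/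

import Mathlib

open scoped Pointwise

/-- A semistar operation on the integral domain `D` with quotient field `K`: a closure operation
`E ↦ E^⋆` on the nonzero `D`-submodules of `K`, compatible with multiplication by nonzero elements
of `K`.  The underlying function is total, but only its values at nonzero submodules are
constrained; no notion below ever evaluates it at `⊥` in a way that matters. -/
structure SemistarOperation (D K : Type*) [CommRing D] [IsDomain D] [Field K] [Algebra D K]
    [IsFractionRing D K] where
  /-- the map `E ↦ E^⋆` -/
  cl : Submodule D K → Submodule D K
  cl_smul : ∀ (x : K) (E : Submodule D K), x ≠ 0 → E ≠ ⊥ → cl (x • E) = x • cl E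
  cl_mono : ∀ E F : Submodule D K, E ≠ ⊥ → F ≠ ⊥ → E ≤ F → cl E ≤ cl F
  le_cl : ∀ E : Submodule D K, E ≠ ⊥ → E ≤ cl E
  cl_cl : ∀ E : Submodule D K, E ≠ ⊥ → cl (cl E) = cl E

namespace SemistarOperation

variable {D K : Type*} [CommRing D] [IsDomain D] [Field K] [Algebra D K] [IsFractionRing D K]

/-- The submodule `⋃ {F^⋆ | F nonzero finitely generated, F ⊆ E}`, written as a supremum; it is the
union for nonzero `E`, see `mem_finCl`. -/
def finCl (s : SemistarOperation D K) (E : Submodule D K) : Submodule D K :=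
  ⨆ F : {F : Submodule D K // F.FG ∧ F ≠ ⊥ ∧ F ≤ E}, s.cl F.1

theorem mem_finCl (s : SemistarOperation D K) {E : Submodule D K} (hE : E ≠ ⊥) (x : K) :
    x ∈ s.finCl E ↔ ∃ F : Submodule D K, F.FG ∧ F ≠ ⊥ ∧ F ≤ E ∧ x ∈ s.cl F := by
  obtain ⟨e, he, he0⟩ := Submodule.exists_mem_ne_zero_of_ne_bot hE
  have : Nonempty {F : Submodule D K // F.FG ∧ F ≠ ⊥ ∧ F ≤ E} :=
    ⟨⟨Submodule.span D {e}, Submodule.fg_span_singleton e,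
      by simpa [Submodule.span_singleton_eq_bot] using he0,
      by simpa [Submodule.span_singleton_le_iff_mem] using he⟩⟩
  unfold finCl
  rw [Submodule.mem_iSup_of_directed]
  · constructor
    · rintro ⟨⟨F, h1, h2, h3⟩, hx⟩
      exact ⟨F, h1, h2, h3, hx⟩
    · rintro ⟨F, h1, h2, h3, hx⟩
      exact ⟨⟨F, h1, h2, h3⟩, hx⟩
  · rintro ⟨F, h1, h2, h3⟩ ⟨G, g1, g2, g3⟩
    have hne : F ⊔ G ≠ ⊥ := fun h => h2 (le_bot_iff.1 (h ▸ le_sup_left))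
    exact ⟨⟨F ⊔ G, h1.sup g1, hne, sup_le h3 g3⟩,
      s.cl_mono _ _ h2 hne le_sup_left, s.cl_mono _ _ g2 hne le_sup_right⟩

theorem finCl_mono (s : SemistarOperation D K) {E F : Submodule D K} (h : E ≤ F) :
    s.finCl E ≤ s.finCl F :=
  iSup_le fun G => le_iSup_of_le
    (⟨G.1, G.2.1, G.2.2.1, G.2.2.2.trans h⟩ :
      {G : Submodule D K // G.FG ∧ G ≠ ⊥ ∧ G ≤ F}) le_rfl

theorem le_finCl (s : SemistarOperation D K) {E : Submodule D K} (hE : E ≠ ⊥) :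
    E ≤ s.finCl E := by
  intro x hx
  rw [s.mem_finCl hE]
  by_cases h0 : x = 0
  · obtain ⟨e, he, he0⟩ := Submodule.exists_mem_ne_zero_of_ne_bot hE
    refine ⟨Submodule.span D {e}, Submodule.fg_span_singleton e,
      by simpa [Submodule.span_singleton_eq_bot] using he0,
      by simpa [Submodule.span_singleton_le_iff_mem] using he, ?_⟩
    rw [h0]
    exact zero_mem _
  · have hb : Submodule.span D {x} ≠ ⊥ := by
      simpa [Submodule.span_singleton_eq_bot] using h0
    exact ⟨Submodule.span D {x}, Submodule.fg_span_singleton x, hb,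
      by simpa [Submodule.span_singleton_le_iff_mem] using hx,
      s.le_cl _ hb (Submodule.mem_span_singleton_self x)⟩

theorem smul_ne_bot {x : K} {E : Submodule D K} (hx : x ≠ 0) (hE : E ≠ ⊥) : x • E ≠ ⊥ := by
  obtain ⟨e, he, he0⟩ := Submodule.exists_mem_ne_zero_of_ne_bot hE
  intro h
  have h1 : x • e ∈ x • E := Submodule.smul_mem_pointwise_smul e x E he
  rw [h, Submodule.mem_bot] at h1
  exact (mul_ne_zero hx he0) h1

theorem smul_finCl_le (s : SemistarOperation D K) {x : K} {E : Submodule D K} (hx : x ≠ 0)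
    (hE : E ≠ ⊥) : x • s.finCl E ≤ s.finCl (x • E) := by
  intro y hy
  obtain ⟨z, hz, rfl⟩ := (Submodule.mem_smul_pointwise_iff_exists y x _).1 hy
  obtain ⟨F, h1, h2, h3, h4⟩ := (s.mem_finCl hE z).1 hz
  refine (s.mem_finCl (smul_ne_bot hx hE) _).2
    ⟨x • F, h1.map _, smul_ne_bot hx h2, Submodule.map_mono h3, ?_⟩
  rw [s.cl_smul x F hx h2]
  exact Submodule.smul_mem_pointwise_smul z x _ h4

/-- The finite-type semistar operation `⋆_f` associated with `⋆`. -/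
def fin (s : SemistarOperation D K) : SemistarOperation D K where
  cl := s.finCl
  cl_smul x E hx hE := by
    refine le_antisymm ?_ (s.smul_finCl_le hx hE)
    have h := s.smul_finCl_le (inv_ne_zero hx) (smul_ne_bot hx hE)
    rw [smul_smul, inv_mul_cancel₀ hx, one_smul] at h
    have h2 : x • (x⁻¹ • s.finCl (x • E)) ≤ x • s.finCl E := Submodule.map_mono h
    rwa [smul_smul, mul_inv_cancel₀ hx, one_smul] at h2
  cl_mono _ _ _ _ h := s.finCl_mono h
  le_cl _ hE := s.le_finCl hE
  cl_cl E hE := by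
    have hne : s.finCl E ≠ ⊥ := fun h => hE (le_bot_iff.1 (h ▸ s.le_finCl hE))
    refine le_antisymm (iSup_le ?_) (s.le_finCl hne)
    rintro ⟨F, hF, hF0, hFE⟩
    have key : ∀ G : Submodule D K, G.FG → G ≤ s.finCl E →
        ∃ H : Submodule D K, H.FG ∧ H ≠ ⊥ ∧ H ≤ E ∧ G ≤ s.cl H := by
      intro G hG
      induction G, hG using Submodule.fg_induction with
      | singleton x =>
        intro hx
        obtain ⟨H, h1, h2, h3, h4⟩ := (s.mem_finCl hE x).1
          (hx (Submodule.mem_span_singleton_self x))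
        exact ⟨H, h1, h2, h3, by simpa [Submodule.span_singleton_le_iff_mem] using h4⟩
      | sup G₁ G₂ _ _ ih₁ ih₂ =>
        intro h
        obtain ⟨H₁, a1, a2, a3, a4⟩ := ih₁ (le_sup_left.trans h)
        obtain ⟨H₂, b1, b2, b3, b4⟩ := ih₂ (le_sup_right.trans h)
        have hb : H₁ ⊔ H₂ ≠ ⊥ := fun h => a2 (le_bot_iff.1 (h ▸ le_sup_left))
        exact ⟨H₁ ⊔ H₂, a1.sup b1, hb, sup_le a3 b3,
          sup_le (a4.trans (s.cl_mono _ _ a2 hb le_sup_left))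
            (b4.trans (s.cl_mono _ _ b2 hb le_sup_right))⟩
    obtain ⟨H, h1, h2, h3, h4⟩ := key F hF hFE
    have hH : s.cl H ≠ ⊥ := fun h => h2 (le_bot_iff.1 (h ▸ s.le_cl H h2))
    have h5 : s.cl F ≤ s.cl H := (s.cl_mono _ _ hF0 hH h4).trans (s.cl_cl H h2).le
    exact h5.trans (le_iSup_of_le
      (⟨H, h1, h2, h3⟩ : {F : Submodule D K // F.FG ∧ F ≠ ⊥ ∧ F ≤ E}) le_rfl)

/-- `I^⋆`, for an ideal `I` of `D` viewed as a `D`-submodule of `K`. -/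
def idealCl (s : SemistarOperation D K) (I : Ideal D) : Submodule D K :=
  s.cl (IsLocalization.coeSubmodule K I)

/-- `I` is a quasi-`⋆`-ideal: `I ≠ 0` and `I^⋆ ∩ D = I`. -/
def IsQuasiIdeal (s : SemistarOperation D K) (I : Ideal D) : Prop :=
  I ≠ ⊥ ∧ (s.idealCl I).comap (Algebra.linearMap D K) = I

/-- `P` is a quasi-`⋆`-prime ideal. -/
def IsQuasiPrime (s : SemistarOperation D K) (P : Ideal D) : Prop :=
  P.IsPrime ∧ s.IsQuasiIdeal P

/-- `M` is a quasi-`⋆`-maximal ideal: maximal among the proper quasi-`⋆`-ideals. -/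
def IsQuasiMaximal (s : SemistarOperation D K) (M : Ideal D) : Prop :=
  Maximal (fun J : Ideal D => J ≠ ⊤ ∧ s.IsQuasiIdeal J) M

/-- `I` is `⋆`-idempotent: `I^⋆ = (I²)^⋆`. -/
def IsIdempotentIdeal (s : SemistarOperation D K) (I : Ideal D) : Prop :=
  s.idealCl I = s.idealCl (I ^ 2)

/-- `I` is `⋆_f`-divisorial: `I^{⋆_f}` is a divisorial ideal of `D^⋆`, that is,
`(D^⋆ : (D^⋆ : I^{⋆_f})) = I^{⋆_f}` (here `A / B = {x ∈ K | x B ⊆ A}` and `1` is `D`). -/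
def IsFinDivisorial (s : SemistarOperation D K) (I : Ideal D) : Prop :=
  s.cl 1 / (s.cl 1 / s.fin.idealCl I) = s.fin.idealCl I

/-- `D` is a Prüfer `⋆`-multiplication domain: `(F F⁻¹)^{⋆_f} = D^{⋆_f}` for every nonzero finitely
generated `D`-submodule `F` of `K`, where `F⁻¹ = (D : F)`. -/
def IsPruferMultiplicationDomain (s : SemistarOperation D K) : Prop :=
  ∀ F : Submodule D K, F.FG → F ≠ ⊥ → s.fin.cl (F * (1 / F)) = s.fin.cl 1

/-- `D` has finite `⋆`-character: every nonzero element of `D` lies in only finitely many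
quasi-`⋆`-maximal ideals. -/
def HasFiniteCharacter (s : SemistarOperation D K) : Prop :=
  ∀ d : D, d ≠ 0 → {M : Ideal D | s.IsQuasiMaximal M ∧ d ∈ M}.Finite

/-- `I` is a `⋆`-product of ideals satisfying `C`: `I^⋆ = (P₁ ⋯ Pₙ)^⋆` with every `Pᵢ` satisfying
`C`.  The empty product `n = 0` is the ideal `D`. -/
def IsStarProductOf (s : SemistarOperation D K) (C : Ideal D → Prop) (I : Ideal D) : Prop :=
  ∃ (n : ℕ) (P : Fin n → Ideal D), (∀ i, C (P i)) ∧ s.idealCl I = s.idealCl (∏ i, P i)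

end SemistarOperation

/-!
Localize at the quasi-`⋆_f`-maximal ideals `M`. In a P`⋆`MD each `D_M` is a valuation domain, and
`I^{⋆_f}` is determined by the localizations `I D_M`. An idempotent proper ideal of a valuation
domain is prime, so a `⋆_f`-idempotent ideal `I` has exactly one minimal quasi-prime below each
`M ⊇ I`, and this prime agrees with `I` in `D_M`. By finite character there are finitely many of
them, and `I` is their `⋆_f`-product.

If one of these primes is quasi-maximal, it is idempotent, so its inverse is `D^⋆`; it can then be
removed from the product without changing the divisorial closure, and `I` is not divisorial.
Conversely, if a minimal quasi-prime `P` is strictly below `M`, finite character provides for each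
`w ∉ P` an element `c ∉ M` with `c / w ∈ (D^⋆ : P)`; these quotients force the divisorial closure
of `I` into `P D_M = I D_M`.
-/

open IsLocalization (coeSubmodule)
open IsLocalRing (maximalIdeal)

section ValuationRing

variable {V : Type*} [CommRing V] [IsDomain V] [ValuationRing V]

theorem isPrime_of_isIdempotentElem {I : Ideal V} (hI : IsIdempotentElem I) (hne : I ≠ ⊤) :
    I.IsPrime := by
  -- `x ∉ I` gives `I ⊆ xV`, so `xy ∈ I = I² ⊆ xI`.
  refine ⟨hne, fun {x y} hxy => or_iff_not_imp_left.2 fun hx => ?_⟩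
  have hIx : I ≤ Ideal.span {x} := by
    intro z hz
    refine Ideal.mem_span_singleton.2 ((ValuationRing.dvd_total x z).resolve_right ?_)
    rintro ⟨c, rfl⟩
    exact hx (I.mul_mem_right c hz)
  have hmem : x * y ∈ Ideal.span {x} * I := Ideal.mul_mono_left hIx (hI.symm ▸ hxy)
  obtain ⟨z, hz, hzy⟩ := Ideal.mem_span_singleton_mul.1 hmem
  have hx0 : x ≠ 0 := fun h => hx (h ▸ I.zero_mem)
  exact mul_left_cancel₀ hx0 hzy ▸ hz

theorem dvd_of_forall_mem_maximalIdeal_dvd_mul (hV : IsIdempotentElem (maximalIdeal V)) {a b : V}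
    (hb : b ≠ 0) (h : ∀ x ∈ maximalIdeal V, b ∣ a * x) : b ∣ a := by
  by_contra hba
  obtain ⟨c, rfl⟩ := (ValuationRing.dvd_total a b).resolve_right hba
  have ha : a ≠ 0 := left_ne_zero_of_mul hb
  have hc : c ∈ maximalIdeal V := fun hu => hba (hu.mul_right_dvd.2 dvd_rfl)
  have hle : maximalIdeal V ≤ Ideal.span {c} := fun x hx =>
    Ideal.mem_span_singleton.2 ((mul_dvd_mul_iff_left ha).1 (h x hx))
  have hmem : c ∈ Ideal.span {c} * maximalIdeal V := Ideal.mul_mono_left hle (hV.symm ▸ hc)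
  obtain ⟨y, hy, hcy⟩ := Ideal.mem_span_singleton_mul.1 hmem
  exact hy ((mul_eq_left₀ (right_ne_zero_of_mul hb)).1 hcy ▸ isUnit_one)

end ValuationRing

section Localization

variable {R : Type*} [CommRing R] {M : Ideal R} [M.IsPrime]

theorem algebraMap_mem_map_atPrime_iff {I : Ideal R} {a : R} :
    algebraMap R (Localization.AtPrime M) a ∈ I.map (algebraMap R (Localization.AtPrime M)) ↔
      ∃ t ∉ M, t * a ∈ I :=
  IsLocalization.algebraMap_mem_map_algebraMap_iff M.primeCompl _ I a

theorem algebraMap_dvd_algebraMap_atPrime_iff {a b : R} :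
    algebraMap R (Localization.AtPrime M) a ∣ algebraMap R (Localization.AtPrime M) b ↔
      ∃ t ∉ M, a ∣ t * b := by
  simp only [← Ideal.mem_span_singleton, ← algebraMap_mem_map_atPrime_iff, Ideal.map_span,
    Set.image_singleton]

theorem isUnit_algebraMap_atPrime {a : R} (ha : a ∉ M) :
    IsUnit (algebraMap R (Localization.AtPrime M) a) :=
  IsLocalization.map_units _ (⟨a, ha⟩ : M.primeCompl)

theorem map_atPrime_le_map_iff {I J : Ideal R} :
    I.map (algebraMap R (Localization.AtPrime M)) ≤ J.map (algebraMap R (Localization.AtPrime M)) ↔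
      ∀ d ∈ I, ∃ t ∉ M, t * d ∈ J :=
  Ideal.map_le_iff_le_comap.trans (forall₂_congr fun _ _ => algebraMap_mem_map_atPrime_iff)

theorem under_map_atPrime_of_le {P : Ideal R} [P.IsPrime] (h : P ≤ M) :
    (P.map (algebraMap R (Localization.AtPrime M))).under R = P :=
  IsLocalization.under_map_of_isPrime_disjoint M.primeCompl _ ‹_›
    (Set.disjoint_left.2 fun _ ha haP => ha (h haP))

theorem under_map_atPrime_le {I P : Ideal R} [P.IsPrime] (hI : I ≤ P) (hP : P ≤ M) :
    (I.map (algebraMap R (Localization.AtPrime M))).under R ≤ P :=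
  (Ideal.comap_mono (Ideal.map_mono hI)).trans (under_map_atPrime_of_le hP).le

theorem map_atPrime_of_not_le {I : Ideal R} (h : ¬ I ≤ M) :
    I.map (algebraMap R (Localization.AtPrime M)) = 1 :=
  (IsLocalization.AtPrime.map_eq_top_of_not_le _ h).trans Ideal.one_eq_top.symm

end Localization

namespace SemistarOperation

variable {D K : Type*} [CommRing D] [Field K] [Algebra D K] [IsFractionRing D K]

theorem coeSubmodule_ne_bot {I : Ideal D} (hI : I ≠ ⊥) : coeSubmodule K I ≠ ⊥ := fun h =>
  hI (IsFractionRing.coeSubmodule_injective D K (h.trans (IsLocalization.coeSubmodule_bot K).symm))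

theorem algebraMap_mem_coeSubmodule {I : Ideal D} {d : D} :
    algebraMap D K d ∈ coeSubmodule K I ↔ d ∈ I :=
  (IsFractionRing.injective D K).mem_set_image (s := (I : Set D))

variable [IsDomain D]

theorem colon_singleton_ne_bot {E : Submodule D K} (hE : E ≠ ⊥) (x : K) : E.colon {x} ≠ ⊥ := by
  obtain ⟨e, he, he0⟩ := Submodule.exists_mem_ne_zero_of_ne_bot hE
  obtain ⟨a, b, hb, hab⟩ := IsFractionRing.div_surjective (A := D) (x / e)
  have hb0 : algebraMap D K b ≠ 0 := IsFractionRing.to_map_ne_zero_of_mem_nonZeroDivisors hb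
  have hbx : b • x = a • e := by
    rw [Algebra.smul_def, Algebra.smul_def, mul_comm, ← div_eq_div_iff he0 hb0, hab]
  have hmem : b ∈ E.colon {x} := Submodule.mem_colon_singleton.2 (hbx ▸ E.smul_mem a he)
  exact Submodule.ne_bot_iff _ |>.2 ⟨b, hmem, nonZeroDivisors.ne_zero hb⟩

variable {s : SemistarOperation D K}

theorem cl_ne_bot {E : Submodule D K} (hE : E ≠ ⊥) : s.cl E ≠ ⊥ :=
  ne_bot_of_le_ne_bot hE (s.le_cl E hE)

theorem cl_le_cl_of_le {E F : Submodule D K} (hE : E ≠ ⊥) (hF : F ≠ ⊥) (h : E ≤ s.cl F) :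
    s.cl E ≤ s.cl F :=
  (s.cl_mono _ _ hE (cl_ne_bot hF) h).trans (s.cl_cl F hF).le

theorem mul_mem_cl {E F : Submodule D K} (hE : E ≠ ⊥) (hF : F ≠ ⊥) {x y : K}
    (h : ∀ e ∈ E, x * e ∈ s.cl F) (hy : y ∈ s.cl E) : x * y ∈ s.cl F := by
  obtain rfl | hx := eq_or_ne x 0
  · exact (zero_mul y).symm ▸ zero_mem _
  have hle : x • E ≤ s.cl F := by
    intro z hz
    obtain ⟨e, he, rfl⟩ := (Submodule.mem_smul_pointwise_iff_exists z x E).1 hz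
    exact h e he
  refine cl_le_cl_of_le (smul_ne_bot hx hE) hF hle ?_
  rw [s.cl_smul x E hx hE]
  exact Submodule.smul_mem_pointwise_smul y x _ hy

theorem mem_cl_of_one_mem_idealCl_colon {E : Submodule D K} (hE : E ≠ ⊥) {x : K}
    (h : (1 : K) ∈ s.idealCl (E.colon {x})) : x ∈ s.cl E := by
  rw [← mul_one x]
  refine mul_mem_cl (coeSubmodule_ne_bot (colon_singleton_ne_bot hE x)) hE (fun e he => ?_) h
  obtain ⟨d, hd, rfl⟩ := (IsLocalization.mem_coeSubmodule K _).1 he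
  refine s.le_cl E hE ?_
  rw [mul_comm, ← Algebra.smul_def]
  exact Submodule.mem_colon_singleton.1 hd

theorem algebraMap_mem_idealCl {I : Ideal D} (hI : I ≠ ⊥) {d : D} (hd : d ∈ I) :
    algebraMap D K d ∈ s.idealCl I :=
  s.le_cl _ (coeSubmodule_ne_bot hI) (algebraMap_mem_coeSubmodule.2 hd)

theorem le_comap_idealCl {I : Ideal D} (hI : I ≠ ⊥) :
    I ≤ (s.idealCl I).comap (Algebra.linearMap D K) := fun _ hd => algebraMap_mem_idealCl hI hd

theorem idealCl_mono {I J : Ideal D} (hI : I ≠ ⊥) (h : I ≤ J) : s.idealCl I ≤ s.idealCl J :=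
  s.cl_mono _ _ (coeSubmodule_ne_bot hI) (coeSubmodule_ne_bot (ne_bot_of_le_ne_bot hI h))
    (IsLocalization.coeSubmodule_mono K h)

theorem idealCl_le_idealCl_iff {I J : Ideal D} (hI : I ≠ ⊥) (hJ : J ≠ ⊥) :
    s.idealCl I ≤ s.idealCl J ↔ ∀ d ∈ I, algebraMap D K d ∈ s.idealCl J := by
  refine ⟨fun h d hd => h (algebraMap_mem_idealCl hI hd), fun h => ?_⟩
  refine cl_le_cl_of_le (coeSubmodule_ne_bot hI) (coeSubmodule_ne_bot hJ) fun x hx => ?_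
  obtain ⟨d, hd, rfl⟩ := (IsLocalization.mem_coeSubmodule K I).1 hx
  exact h d hd

theorem isQuasiIdeal_of_forall_mem {I : Ideal D} (hI : I ≠ ⊥)
    (h : ∀ d, algebraMap D K d ∈ s.idealCl I → d ∈ I) : s.IsQuasiIdeal I :=
  ⟨hI, le_antisymm h (le_comap_idealCl hI)⟩

theorem IsQuasiIdeal.algebraMap_mem_idealCl_iff {I : Ideal D} (hI : s.IsQuasiIdeal I) {d : D} :
    algebraMap D K d ∈ s.idealCl I ↔ d ∈ I :=
  SetLike.ext_iff.1 hI.2 d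

theorem IsQuasiIdeal.one_mem_idealCl_iff {I : Ideal D} (hI : s.IsQuasiIdeal I) :
    (1 : K) ∈ s.idealCl I ↔ I = ⊤ := by
  rw [← map_one (algebraMap D K), hI.algebraMap_mem_idealCl_iff, Ideal.eq_top_iff_one]

theorem IsQuasiIdeal.le_of_idealCl_le {I J : Ideal D} (hI : I ≠ ⊥) (hJ : s.IsQuasiIdeal J)
    (h : s.idealCl I ≤ s.idealCl J) : I ≤ J := fun _ hd =>
  hJ.algebraMap_mem_idealCl_iff.1 (h (algebraMap_mem_idealCl hI hd))

theorem isQuasiIdeal_comap_idealCl {I : Ideal D} (hI : I ≠ ⊥) :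
    s.IsQuasiIdeal ((s.idealCl I).comap (Algebra.linearMap D K)) := by
  have hne : (s.idealCl I).comap (Algebra.linearMap D K) ≠ ⊥ :=
    ne_bot_of_le_ne_bot hI (le_comap_idealCl hI)
  exact isQuasiIdeal_of_forall_mem hne fun d hd =>
    (idealCl_le_idealCl_iff hne hI).2 (fun _ h => h) hd

theorem IsQuasiIdeal.colon_singleton {I : Ideal D} (hI : s.IsQuasiIdeal I) (y : D) :
    s.IsQuasiIdeal (I.colon {y}) := by
  have hne : I.colon {y} ≠ ⊥ := ne_bot_of_le_ne_bot hI.1 fun d hd =>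
    Submodule.mem_colon_singleton.2 (I.mul_mem_right y hd)
  refine isQuasiIdeal_of_forall_mem hne fun d hd => Submodule.mem_colon_singleton.2 ?_
  rw [smul_eq_mul, mul_comm, ← hI.algebraMap_mem_idealCl_iff, map_mul]
  refine mul_mem_cl (coeSubmodule_ne_bot hne) (coeSubmodule_ne_bot hI.1) (fun e he => ?_) hd
  obtain ⟨c, hc, rfl⟩ := (IsLocalization.mem_coeSubmodule K _).1 he
  rw [← map_mul]
  refine algebraMap_mem_idealCl hI.1 ?_
  rw [mul_comm]
  exact Submodule.mem_colon_singleton.1 hc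

theorem IsQuasiMaximal.isPrime {M : Ideal D} (hM : s.IsQuasiMaximal M) : M.IsPrime := by
  refine ⟨hM.prop.1, fun {x y} hxy => or_iff_not_imp_right.2 fun hy => ?_⟩
  have hne : M.colon {y} ≠ ⊤ := fun h => by
    refine hy (one_mul y ▸ Submodule.mem_colon_singleton.1 (?_ : (1 : D) ∈ M.colon {y}))
    exact h ▸ Submodule.mem_top
  have hle : M.colon {y} ≤ M :=
    hM.le_of_ge ⟨hne, hM.prop.2.colon_singleton y⟩ fun d hd =>
      Submodule.mem_colon_singleton.2 (M.mul_mem_right y hd)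
  exact hle (Submodule.mem_colon_singleton.2 hxy)

theorem fin_cl_bot : s.fin.cl ⊥ = ⊥ :=
  le_bot_iff.1 (iSup_le fun F => (F.2.2.1 (le_bot_iff.1 F.2.2.2)).elim)

theorem fin_cl_one : s.fin.cl 1 = s.cl 1 := by
  have hfg : (1 : Submodule D K).FG := by
    rw [Submodule.one_eq_span]
    exact Submodule.fg_span_singleton 1
  refine le_antisymm (iSup_le fun F => s.cl_mono _ _ F.2.2.1 one_ne_zero F.2.2.2) fun x hx => ?_
  exact (s.mem_finCl one_ne_zero x).2 ⟨1, hfg, one_ne_zero, le_rfl, hx⟩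

theorem exists_mem_fin_cl_of_directedOn {c : Set (Submodule D K)} (hne : c.Nonempty)
    (hc : DirectedOn (· ≤ ·) c) {E : Submodule D K} (hE : IsLUB c E) {x : K}
    (hx : x ∈ s.fin.cl E) : ∃ F ∈ c, x ∈ s.fin.cl F := by
  obtain rfl | hE0 := eq_or_ne E ⊥
  · rw [fin_cl_bot, Submodule.mem_bot] at hx
    exact hne.imp fun F hF => ⟨hF, hx ▸ zero_mem _⟩
  obtain ⟨G, hG, hG0, hGE, hxG⟩ := (s.mem_finCl hE0 x).1 hx
  obtain ⟨F, hF, hGF⟩ := (Submodule.fg_iff_compact G).1 hG c E hne hc hE hGE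
  exact ⟨F, hF, (s.mem_finCl (ne_bot_of_le_ne_bot hG0 hGF) x).2 ⟨G, hG, hG0, hGF, hxG⟩⟩

theorem exists_mem_fin_idealCl_of_mem_sSup {c : Set (Ideal D)} (hne : c.Nonempty)
    (hc : IsChain (· ≤ ·) c) {x : K} (hx : x ∈ s.fin.idealCl (sSup c)) :
    ∃ J ∈ c, x ∈ s.fin.idealCl J := by
  have hlub : IsLUB (coeSubmodule K '' c) (coeSubmodule K (sSup c)) :=
    (Submodule.gc_map_comap (Algebra.linearMap D K)).isLUB_l_image (isLUB_sSup c)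
  have hdir : DirectedOn (· ≤ ·) (coeSubmodule K '' c) :=
    DirectedOn.mono_comp (fun _ _ h => IsLocalization.coeSubmodule_mono K h) hc.directedOn
  obtain ⟨_, ⟨J, hJ, rfl⟩, hxJ⟩ := exists_mem_fin_cl_of_directedOn (hne.image _) hdir hlub hx
  exact ⟨J, hJ, hxJ⟩

theorem IsQuasiIdeal.exists_isQuasiMaximal_ge {I : Ideal D} (hI : s.fin.IsQuasiIdeal I)
    (hne : I ≠ ⊤) : ∃ M, s.fin.IsQuasiMaximal M ∧ I ≤ M := by
  suffices h : ∀ c ⊆ {J : Ideal D | J ≠ ⊤ ∧ s.fin.IsQuasiIdeal J}, IsChain (· ≤ ·) c → ∀ J ∈ c,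
      sSup c ∈ {J : Ideal D | J ≠ ⊤ ∧ s.fin.IsQuasiIdeal J} by
    obtain ⟨M, hIM, hM⟩ := zorn_le_nonempty₀ _
      (fun c hc hchain J hJ => ⟨sSup c, h c hc hchain J hJ, fun _ => le_sSup⟩) I ⟨hne, hI⟩
    exact ⟨M, hM, hIM⟩
  intro c hc hchain J hJ
  have hmem : ∀ d, algebraMap D K d ∈ s.fin.idealCl (sSup c) → ∃ J ∈ c, d ∈ J := fun d hd =>
    have ⟨J', hJ', hd'⟩ := exists_mem_fin_idealCl_of_mem_sSup ⟨J, hJ⟩ hchain hd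
    ⟨J', hJ', (hc hJ').2.algebraMap_mem_idealCl_iff.1 hd'⟩
  have hquasi : s.fin.IsQuasiIdeal (sSup c) :=
    isQuasiIdeal_of_forall_mem (ne_bot_of_le_ne_bot (hc hJ).2.1 (le_sSup hJ)) fun d hd =>
      have ⟨_, hJ', hd'⟩ := hmem d hd
      le_sSup hJ' hd'
  refine ⟨fun htop => ?_, hquasi⟩
  obtain ⟨J', hJ', h1⟩ := hmem 1 (hquasi.algebraMap_mem_idealCl_iff.2 (htop ▸ Submodule.mem_top))
  exact (hc hJ').1 ((Ideal.eq_top_iff_one J').2 h1)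

theorem one_mem_fin_idealCl_iff {I : Ideal D} (hI : I ≠ ⊥) :
    (1 : K) ∈ s.fin.idealCl I ↔ ∀ M, s.fin.IsQuasiMaximal M → ¬ I ≤ M := by
  refine ⟨fun h M hM hIM => hM.prop.1 (hM.prop.2.one_mem_idealCl_iff.1 (idealCl_mono hI hIM h)),
    fun h => ?_⟩
  by_contra h1
  have htop : (s.fin.idealCl I).comap (Algebra.linearMap D K) ≠ ⊤ := fun htop => by
    rw [Ideal.eq_top_iff_one, Submodule.mem_comap, Algebra.linearMap_apply, map_one] at htop
    exact h1 htop
  obtain ⟨M, hM, hle⟩ := (isQuasiIdeal_comap_idealCl hI).exists_isQuasiMaximal_ge htop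
  exact h M hM ((le_comap_idealCl hI).trans hle)

namespace IsPruferMultiplicationDomain

theorem one_mem_fin_cl_of_mul_one_div_le
    (hD : s.IsPruferMultiplicationDomain) {F E : Submodule D K} (hF : F.FG) (hF0 : F ≠ ⊥)
    (hE : E ≠ ⊥) (h : F * (1 / F) ≤ s.fin.cl E) : (1 : K) ∈ s.fin.cl E := by
  have h1 : (1 : K) ∈ s.fin.cl (F * (1 / F)) :=
    hD F hF hF0 ▸ s.fin.le_cl 1 one_ne_zero (Submodule.mem_one.2 ⟨1, map_one _⟩)
  have hne : F * (1 / F) ≠ ⊥ := fun hbot => by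
    rw [hbot, fin_cl_bot, Submodule.mem_bot] at h1
    exact one_ne_zero h1
  exact cl_le_cl_of_le hne hE h h1

theorem one_mem_idealCl_colon (hD : s.IsPruferMultiplicationDomain)
    {E : Submodule D K} (hE : E ≠ ⊥) {x : K} (hx : x ∈ s.fin.cl E) :
    (1 : K) ∈ s.fin.idealCl (E.colon {x}) := by
  -- If `x ∈ F^⋆` with `F ⊆ E` and `G = F + Dx`, then `G ⊆ F^⋆` and `h • F ⊆ (E : x)` for all
  -- `h ∈ (D : G)`, so `G (D : G) ⊆ (E : x)^⋆`.
  obtain ⟨F, hF, hF0, hFE, hxF⟩ := (s.mem_finCl hE x).1 hx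
  have hG0 : F ⊔ Submodule.span D {x} ≠ ⊥ := ne_bot_of_le_ne_bot hF0 le_sup_left
  generalize hG : F ⊔ Submodule.span D {x} = G at hG0
  have hGF : G ≤ s.fin.cl F := hG ▸ sup_le (s.fin.le_cl F hF0)
    ((Submodule.span_singleton_le_iff_mem _ _).2
      ((s.mem_finCl hF0 x).2 ⟨F, hF, hF0, le_rfl, hxF⟩))
  have hFG : F ≤ G := hG ▸ le_sup_left
  have hxG : x ∈ G := hG ▸ Submodule.mem_sup_right (Submodule.mem_span_singleton_self x)
  have hGfg : G.FG := hG ▸ hF.sup (Submodule.fg_span_singleton x)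
  have hcolon : E.colon {x} ≠ ⊥ := colon_singleton_ne_bot hE x
  refine hD.one_mem_fin_cl_of_mul_one_div_le hGfg hG0 (coeSubmodule_ne_bot hcolon)
    (Submodule.mul_le.2 fun g hg h hh => ?_)
  rw [mul_comm]
  refine mul_mem_cl hF0 (coeSubmodule_ne_bot hcolon) (fun f hf => ?_) (hGF hg)
  obtain ⟨d, hd⟩ := Submodule.mem_one.1 (Submodule.mem_div_iff_forall_mul_mem.1 hh f (hFG hf))
  obtain ⟨c, hc⟩ := Submodule.mem_one.1 (Submodule.mem_div_iff_forall_mul_mem.1 hh x hxG)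
  have hdx : d • x = c • f := by
    rw [Algebra.smul_def, Algebra.smul_def, hd, hc, mul_right_comm]
  rw [← hd]
  exact algebraMap_mem_idealCl hcolon
    (Submodule.mem_colon_singleton.2 (hdx ▸ E.smul_mem c (hFE hf)))

theorem mem_fin_cl_iff (hD : s.IsPruferMultiplicationDomain)
    {E : Submodule D K} (hE : E ≠ ⊥) {x : K} :
    x ∈ s.fin.cl E ↔ ∀ M, s.fin.IsQuasiMaximal M → ∃ t ∉ M, t • x ∈ E := by
  rw [show x ∈ s.fin.cl E ↔ (1 : K) ∈ s.fin.idealCl (E.colon {x}) from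
    ⟨hD.one_mem_idealCl_colon hE, mem_cl_of_one_mem_idealCl_colon hE⟩,
    one_mem_fin_idealCl_iff (colon_singleton_ne_bot hE x)]
  simp only [SetLike.not_le_iff_exists, Submodule.mem_colon_singleton, and_comm]

theorem algebraMap_dvd_or_dvd (hD : s.IsPruferMultiplicationDomain)
    {M : Ideal D} [M.IsPrime] (hM : s.fin.IsQuasiMaximal M) (a b : D) :
    algebraMap D (Localization.AtPrime M) a ∣ algebraMap D (Localization.AtPrime M) b ∨
      algebraMap D (Localization.AtPrime M) b ∣ algebraMap D (Localization.AtPrime M) a := by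
  obtain rfl | ha := eq_or_ne a 0
  · exact Or.inr (map_zero (algebraMap D (Localization.AtPrime M)) ▸ dvd_zero _)
  by_contra! hab
  simp only [algebraMap_dvd_algebraMap_atPrime_iff, not_exists, not_and] at hab
  set F : Submodule D K := Submodule.span D {algebraMap D K a, algebraMap D K b}
  have hF0 : F ≠ ⊥ := (Submodule.ne_bot_iff F).2
    ⟨_, Submodule.subset_span (Set.mem_insert _ _),
      (map_ne_zero_iff _ (IsFractionRing.injective D K)).2 ha⟩
  have hle : F * (1 / F) ≤ coeSubmodule K M := by
    refine Submodule.mul_le.2 fun f hf h hh => ?_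
    rw [Submodule.mem_div_iff_forall_mul_mem] at hh
    obtain ⟨p, hp⟩ := Submodule.mem_one.1 (hh _ (Submodule.subset_span (Set.mem_insert _ _)))
    obtain ⟨q, hq⟩ := Submodule.mem_one.1
      (hh _ (Submodule.subset_span (Set.mem_insert_of_mem _ rfl)))
    have hpq : p * b = q * a := IsFractionRing.injective D K <| by
      rw [map_mul, map_mul, hp, hq, mul_right_comm]
    have hpM : p ∈ M := by_contra fun hpM => hab.1 p hpM (hpq ▸ dvd_mul_left a q)
    have hqM : q ∈ M := by_contra fun hqM => hab.2 q hqM (hpq ▸ dvd_mul_left b p)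
    obtain ⟨c, d, rfl⟩ := Submodule.mem_span_pair.1 hf
    have hsum : (c • algebraMap D K a + d • algebraMap D K b) * h =
        algebraMap D K (c * p + d * q) := by
      simp only [Algebra.smul_def, map_add, map_mul, hp, hq]
      ring
    rw [hsum, algebraMap_mem_coeSubmodule]
    exact add_mem (M.mul_mem_left c hpM) (M.mul_mem_left d hqM)
  have hM0 : coeSubmodule K M ≠ ⊥ := coeSubmodule_ne_bot hM.prop.2.1
  exact hM.prop.1 (hM.prop.2.one_mem_idealCl_iff.1
    (hD.one_mem_fin_cl_of_mul_one_div_le (Submodule.fg_span (Set.toFinite _)) hF0 hM0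
      (hle.trans (s.fin.le_cl _ hM0))))

theorem valuationRing_localization
    (hD : s.IsPruferMultiplicationDomain) {M : Ideal D} [M.IsPrime]
    (hM : s.fin.IsQuasiMaximal M) : ValuationRing (Localization.AtPrime M) := by
  refine ValuationRing.iff_dvd_total.2 ⟨fun x y => ?_⟩
  obtain ⟨⟨a, t⟩, hx⟩ := IsLocalization.surj M.primeCompl x
  obtain ⟨⟨b, u⟩, hy⟩ := IsLocalization.surj M.primeCompl y
  have ht := IsLocalization.map_units (Localization.AtPrime M) t
  have hu := IsLocalization.map_units (Localization.AtPrime M) u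
  have h := hD.algebraMap_dvd_or_dvd hM a b
  rwa [← hx, ← hy, ht.mul_right_dvd, hu.dvd_mul_right, hu.mul_right_dvd, ht.dvd_mul_right] at h

theorem algebraMap_mem_idealCl_iff
    (hD : s.IsPruferMultiplicationDomain) {I : Ideal D} (hI : I ≠ ⊥) {d : D} :
    algebraMap D K d ∈ s.fin.idealCl I ↔ ∀ M, s.fin.IsQuasiMaximal M → ∃ t ∉ M, t * d ∈ I := by
  simp only [idealCl, hD.mem_fin_cl_iff (coeSubmodule_ne_bot hI), Algebra.smul_def, ← map_mul,
    algebraMap_mem_coeSubmodule]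

theorem div_mem_cl_one_iff (hD : s.IsPruferMultiplicationDomain)
    {a b : D} (hb : b ≠ 0) :
    algebraMap D K a / algebraMap D K b ∈ s.cl 1 ↔
      ∀ (M : Ideal D) [M.IsPrime], s.fin.IsQuasiMaximal M →
        algebraMap D (Localization.AtPrime M) b ∣ algebraMap D (Localization.AtPrime M) a := by
  have hb' : algebraMap D K b ≠ 0 := (map_ne_zero_iff _ (IsFractionRing.injective D K)).2 hb
  have hone : ∀ t : D, t • (algebraMap D K a / algebraMap D K b) ∈ (1 : Submodule D K) ↔
      b ∣ t * a := fun t => by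
    rw [Submodule.mem_one, Algebra.smul_def, ← mul_div_assoc, ← map_mul]
    simp only [eq_div_iff hb', ← map_mul, (IsFractionRing.injective D K).eq_iff]
    exact ⟨fun ⟨c, hc⟩ => ⟨c, by rw [← hc, mul_comm]⟩, fun ⟨c, hc⟩ => ⟨c, by rw [hc, mul_comm]⟩⟩
  rw [← fin_cl_one, hD.mem_fin_cl_iff one_ne_zero]
  simp only [hone, algebraMap_dvd_algebraMap_atPrime_iff]
  exact ⟨fun h M _ hM => h M hM, fun h M hM => have := hM.isPrime; h M hM⟩

theorem idealCl_le_idealCl_iff (hD : s.IsPruferMultiplicationDomain)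
    {I J : Ideal D} (hI : I ≠ ⊥) (hJ : J ≠ ⊥) :
    s.fin.idealCl I ≤ s.fin.idealCl J ↔ ∀ (M : Ideal D) [M.IsPrime], s.fin.IsQuasiMaximal M →
      I.map (algebraMap D (Localization.AtPrime M)) ≤
        J.map (algebraMap D (Localization.AtPrime M)) := by
  simp only [SemistarOperation.idealCl_le_idealCl_iff hI hJ, hD.algebraMap_mem_idealCl_iff hJ,
    map_atPrime_le_map_iff]
  exact ⟨fun h M _ hM d hd => h d hd M hM, fun h d hd M hM => have := hM.isPrime; h M hM d hd⟩

theorem idealCl_eq_idealCl_iff (hD : s.IsPruferMultiplicationDomain)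
    {I J : Ideal D} (hI : I ≠ ⊥) (hJ : J ≠ ⊥) :
    s.fin.idealCl I = s.fin.idealCl J ↔ ∀ (M : Ideal D) [M.IsPrime], s.fin.IsQuasiMaximal M →
      I.map (algebraMap D (Localization.AtPrime M)) =
        J.map (algebraMap D (Localization.AtPrime M)) := by
  simp only [le_antisymm_iff, hD.idealCl_le_idealCl_iff hI hJ, hD.idealCl_le_idealCl_iff hJ hI,
    ← forall_and]

theorem isIdempotentIdeal_iff (hD : s.IsPruferMultiplicationDomain)
    {I : Ideal D} (hI : I ≠ ⊥) :
    s.fin.IsIdempotentIdeal I ↔ ∀ (M : Ideal D) [M.IsPrime], s.fin.IsQuasiMaximal M →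
      IsIdempotentElem (I.map (algebraMap D (Localization.AtPrime M))) := by
  rw [IsIdempotentIdeal, hD.idealCl_eq_idealCl_iff hI (pow_ne_zero 2 hI)]
  exact forall₃_congr fun M _ _ => by rw [Ideal.map_pow, pow_two, IsIdempotentElem, eq_comm]

theorem isQuasiPrime_of_le (hD : s.IsPruferMultiplicationDomain)
    {P M : Ideal D} (hP : P.IsPrime) (hP0 : P ≠ ⊥) (hM : s.fin.IsQuasiMaximal M) (h : P ≤ M) :
    s.fin.IsQuasiPrime P := by
  refine ⟨hP, isQuasiIdeal_of_forall_mem hP0 fun d hd => ?_⟩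
  obtain ⟨t, ht, htd⟩ := (hD.algebraMap_mem_idealCl_iff hP0).1 hd M hM
  exact (hP.mem_or_mem htd).resolve_left fun htP => ht (h htP)

end IsPruferMultiplicationDomain

/-- The minimal elements among the quasi-`⋆`-primes containing `I`, the analogue for `⋆` of
`Ideal.minimalPrimes`. -/
def minimalQuasiPrimes (s : SemistarOperation D K) (I : Ideal D) : Set (Ideal D) :=
  {P | Minimal (fun Q => s.IsQuasiPrime Q ∧ I ≤ Q) P}

theorem eq_of_mem_minimalQuasiPrimes {I P Q : Ideal D} (hP : P ∈ s.minimalQuasiPrimes I)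
    (hQ : s.IsQuasiPrime Q) (hIQ : I ≤ Q) (hQP : Q ≤ P) : Q = P :=
  le_antisymm hQP (hP.2 ⟨hQ, hIQ⟩ hQP)

theorem IsQuasiPrime.le_iff_exists_le {ι : Type*} {S : Finset ι} {P : ι → Ideal D}
    {I Q : Ideal D} (hQ : s.IsQuasiPrime Q) (hI : I ≠ ⊥) (hP : ∀ i ∈ S, P i ≠ ⊥)
    (h : s.idealCl I = s.idealCl (∏ i ∈ S, P i)) : I ≤ Q ↔ ∃ i ∈ S, P i ≤ Q := by
  have hprod : ∏ i ∈ S, P i ≠ ⊥ := Finset.prod_ne_zero_iff.2 hP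
  rw [← hQ.1.prod_le]
  exact ⟨fun hIQ => hQ.2.le_of_idealCl_le hprod (h ▸ idealCl_mono hI hIQ),
    fun hle => hQ.2.le_of_idealCl_le hI (h ▸ idealCl_mono hprod hle)⟩

theorem coe_eq_minimalQuasiPrimes {I : Ideal D} (hI : I ≠ ⊥) {S : Finset (Ideal D)}
    (hS : ∀ P ∈ S, s.IsQuasiPrime P) (hanti : IsAntichain (· ≤ ·) (S : Set (Ideal D)))
    (h : s.idealCl I = s.idealCl (∏ P ∈ S, P)) : (S : Set (Ideal D)) = s.minimalQuasiPrimes I := by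
  have hle : ∀ Q, s.IsQuasiPrime Q → (I ≤ Q ↔ ∃ P ∈ S, P ≤ Q) := fun Q hQ =>
    hQ.le_iff_exists_le hI (fun P hP => (hS P hP).2.1) h
  refine Set.Subset.antisymm (fun P hP => ?_) fun Q hQ => ?_
  · refine ⟨⟨hS P hP, (hle P (hS P hP)).2 ⟨P, hP, le_rfl⟩⟩, fun Q hQ hQP => ?_⟩
    obtain ⟨P', hP', hP'Q⟩ := (hle Q hQ.1).1 hQ.2
    exact hanti.eq hP' hP (hP'Q.trans hQP) ▸ hP'Q
  · obtain ⟨P, hP, hPQ⟩ := (hle Q hQ.1.1).1 hQ.1.2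
    exact eq_of_mem_minimalQuasiPrimes hQ (hS P hP)
      ((hle P (hS P hP)).2 ⟨P, hP, le_rfl⟩) hPQ ▸ hP

theorem isStarProductOf_of_finset {C : Ideal D → Prop} {I : Ideal D} {S : Finset (Ideal D)}
    (hS : ∀ P ∈ S, C P) (h : s.idealCl I = s.idealCl (∏ P ∈ S, P)) : s.IsStarProductOf C I := by
  refine ⟨S.card, fun i => S.equivFin.symm i, fun i => hS _ (S.equivFin.symm i).2, ?_⟩
  rw [h, Equiv.prod_comp S.equivFin.symm (fun P : S => (P : Ideal D)),
    Finset.prod_coe_sort S (fun P => P)]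

namespace IsPruferMultiplicationDomain

theorem isQuasiPrime_under_map (hD : s.IsPruferMultiplicationDomain) {I : Ideal D} (hI : I ≠ ⊥)
    (hidem : s.fin.IsIdempotentIdeal I) {M : Ideal D} [M.IsPrime] (hM : s.fin.IsQuasiMaximal M)
    (hIM : I ≤ M) :
    s.fin.IsQuasiPrime ((I.map (algebraMap D (Localization.AtPrime M))).under D) := by
  have := hD.valuationRing_localization hM
  have hprime : (I.map (algebraMap D (Localization.AtPrime M))).IsPrime :=
    isPrime_of_isIdempotentElem ((hD.isIdempotentIdeal_iff hI).1 hidem M hM)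
      ((IsLocalization.map_algebraMap_ne_top_iff_disjoint M.primeCompl _ I).2
        (Set.disjoint_left.2 fun _ ha haI => ha (hIM haI)))
  exact hD.isQuasiPrime_of_le (hprime.under D) (ne_bot_of_le_ne_bot hI Ideal.le_comap_map) hM
    (under_map_atPrime_le hIM le_rfl)

theorem mem_minimalQuasiPrimes_iff (hD : s.IsPruferMultiplicationDomain) {I : Ideal D}
    (hI : I ≠ ⊥) (hidem : s.fin.IsIdempotentIdeal I) {M : Ideal D} [M.IsPrime]
    (hM : s.fin.IsQuasiMaximal M) (hIM : I ≤ M) {P : Ideal D} (hPM : P ≤ M) :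
    P ∈ s.fin.minimalQuasiPrimes I ↔
      P = (I.map (algebraMap D (Localization.AtPrime M))).under D := by
  have hquasi := hD.isQuasiPrime_under_map hI hidem hM hIM
  constructor
  · intro hP
    have := hP.1.1.1
    exact (eq_of_mem_minimalQuasiPrimes hP hquasi Ideal.le_comap_map
      (under_map_atPrime_le hP.1.2 hPM)).symm
  · rintro rfl
    refine ⟨⟨hquasi, Ideal.le_comap_map⟩, fun Q hQ hle => ?_⟩
    have := hQ.1.1
    exact under_map_atPrime_le hQ.2 (hle.trans hPM)

theorem map_eq_map_of_mem_minimalQuasiPrimes (hD : s.IsPruferMultiplicationDomain) {I : Ideal D}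
    (hI : I ≠ ⊥) (hidem : s.fin.IsIdempotentIdeal I) {M : Ideal D} [M.IsPrime]
    (hM : s.fin.IsQuasiMaximal M) {P : Ideal D} (hP : P ∈ s.fin.minimalQuasiPrimes I)
    (hPM : P ≤ M) : P.map (algebraMap D (Localization.AtPrime M)) =
      I.map (algebraMap D (Localization.AtPrime M)) := by
  rw [(hD.mem_minimalQuasiPrimes_iff hI hidem hM (hP.1.2.trans hPM) hPM).1 hP]
  exact IsLocalization.map_under M.primeCompl _ _

theorem isIdempotentIdeal_of_mem_minimalQuasiPrimes (hD : s.IsPruferMultiplicationDomain)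
    {I : Ideal D} (hI : I ≠ ⊥) (hidem : s.fin.IsIdempotentIdeal I) {P : Ideal D}
    (hP : P ∈ s.fin.minimalQuasiPrimes I) : s.fin.IsIdempotentIdeal P := by
  refine (hD.isIdempotentIdeal_iff hP.1.1.2.1).2 fun M _ hM => ?_
  by_cases hPM : P ≤ M
  · rw [hD.map_eq_map_of_mem_minimalQuasiPrimes hI hidem hM hP hPM]
    exact (hD.isIdempotentIdeal_iff hI).1 hidem M hM
  · rw [map_atPrime_of_not_le hPM]
    exact IsIdempotentElem.one

theorem finite_minimalQuasiPrimes (hD : s.IsPruferMultiplicationDomain)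
    (hfin : s.fin.HasFiniteCharacter) {I : Ideal D} (hI : I ≠ ⊥)
    (hidem : s.fin.IsIdempotentIdeal I) : (s.fin.minimalQuasiPrimes I).Finite := by
  obtain ⟨d, hd, hd0⟩ := Submodule.exists_mem_ne_zero_of_ne_bot hI
  have hmax : ∀ P ∈ s.fin.minimalQuasiPrimes I, ∃ M, s.fin.IsQuasiMaximal M ∧ P ≤ M :=
    fun P hP => hP.1.1.2.exists_isQuasiMaximal_ge hP.1.1.1.ne_top
  choose! max hmax hle using hmax
  have hmaps : Set.MapsTo max (s.fin.minimalQuasiPrimes I)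
      {M | s.fin.IsQuasiMaximal M ∧ d ∈ M} := fun P hP => ⟨hmax P hP, hle P hP (hP.1.2 hd)⟩
  refine Set.Finite.of_injOn hmaps (fun P hP Q hQ hPQ => ?_) (hfin d hd0)
  have := (hmax P hP).isPrime
  have hI_le := hP.1.2.trans (hle P hP)
  rw [(hD.mem_minimalQuasiPrimes_iff hI hidem (hmax P hP) hI_le (hle P hP)).1 hP,
    (hD.mem_minimalQuasiPrimes_iff hI hidem (hmax P hP) hI_le (hPQ ▸ hle Q hQ)).1 hQ]

theorem idealCl_eq_idealCl_prod (hD : s.IsPruferMultiplicationDomain) {I : Ideal D} (hI : I ≠ ⊥)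
    (hidem : s.fin.IsIdempotentIdeal I) {S : Finset (Ideal D)}
    (hS : (S : Set (Ideal D)) = s.fin.minimalQuasiPrimes I) :
    s.fin.idealCl I = s.fin.idealCl (∏ P ∈ S, P) := by
  have hmem : ∀ P, P ∈ S ↔ P ∈ s.fin.minimalQuasiPrimes I := fun P => by
    rw [← hS, Finset.mem_coe]
  have hprod : ∏ P ∈ S, P ≠ ⊥ :=
    Finset.prod_ne_zero_iff.2 fun P hP => ((hmem P).1 hP).1.1.2.1
  refine (hD.idealCl_eq_idealCl_iff hI hprod).2 fun M _ hM => ?_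
  rw [← Ideal.mapHom_apply _ (∏ P ∈ S, P), map_prod]
  simp only [Ideal.mapHom_apply]
  by_cases hIM : I ≤ M
  · set P₀ := (I.map (algebraMap D (Localization.AtPrime M))).under D
    have hP₀M : P₀ ≤ M := under_map_atPrime_le hIM le_rfl
    have hiff : ∀ P ≤ M, P ∈ s.fin.minimalQuasiPrimes I ↔ P = P₀ := fun P =>
      hD.mem_minimalQuasiPrimes_iff hI hidem hM hIM
    rw [Finset.prod_eq_single_of_mem P₀ ((hmem P₀).2 ((hiff P₀ hP₀M).2 rfl)) fun P hP hne =>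
      map_atPrime_of_not_le fun hPM => hne ((hiff P hPM).1 ((hmem P).1 hP))]
    exact (IsLocalization.map_under M.primeCompl _ _).symm
  · rw [map_atPrime_of_not_le hIM, Finset.prod_eq_one fun P hP =>
      map_atPrime_of_not_le fun hPM => hIM (((hmem P).1 hP).1.2.trans hPM)]

theorem isIdempotentIdeal_of_isStarProductOf (hD : s.IsPruferMultiplicationDomain)
    {C : Ideal D → Prop} (hC : ∀ P, C P → P ≠ ⊥ ∧ s.fin.IsIdempotentIdeal P) {I : Ideal D}
    (hI : I ≠ ⊥) (h : s.fin.IsStarProductOf C I) : s.fin.IsIdempotentIdeal I := by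
  obtain ⟨n, P, hP, hIP⟩ := h
  have hprod : ∏ i, P i ≠ ⊥ := Finset.prod_ne_zero_iff.2 fun i _ => (hC _ (hP i)).1
  refine (hD.isIdempotentIdeal_iff hI).2 fun M _ hM => ?_
  rw [(hD.idealCl_eq_idealCl_iff hI hprod).1 hIP M hM, ← Ideal.mapHom_apply, map_prod]
  exact Finset.prod_induction _ IsIdempotentElem (fun _ _ => IsIdempotentElem.mul)
    IsIdempotentElem.one fun i _ =>
      (hD.isIdempotentIdeal_iff (hC _ (hP i)).1).1 (hC _ (hP i)).2 M hM

theorem of_mem_minimalQuasiPrimes_of_isStarProductOf (hD : s.IsPruferMultiplicationDomain)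
    {C : Ideal D → Prop} (hC : ∀ P, C P → P.IsPrime ∧ P ≠ ⊥) {I : Ideal D} (hI : I ≠ ⊥)
    (h : s.fin.IsStarProductOf C I) {Q : Ideal D} (hQ : Q ∈ s.fin.minimalQuasiPrimes I) : C Q := by
  obtain ⟨n, P, hP, hIP⟩ := h
  have hle : ∀ Q', s.fin.IsQuasiPrime Q' → (I ≤ Q' ↔ ∃ i ∈ Finset.univ, P i ≤ Q') :=
    fun Q' hQ' => hQ'.le_iff_exists_le hI (fun i _ => (hC _ (hP i)).2) hIP
  obtain ⟨i, -, hi⟩ := (hle Q hQ.1.1).1 hQ.1.2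
  obtain ⟨M, hM, hQM⟩ := hQ.1.1.2.exists_isQuasiMaximal_ge hQ.1.1.1.ne_top
  have hquasi : s.fin.IsQuasiPrime (P i) :=
    hD.isQuasiPrime_of_le (hC _ (hP i)).1 (hC _ (hP i)).2 hM (hi.trans hQM)
  exact eq_of_mem_minimalQuasiPrimes hQ hquasi
    ((hle _ hquasi).2 ⟨i, Finset.mem_univ i, le_rfl⟩) hi ▸ hP i

theorem isStarProductOf_iff (hD : s.IsPruferMultiplicationDomain)
    (hfin : s.fin.HasFiniteCharacter) {C : Ideal D → Prop}
    (hC : ∀ P, C P → P.IsPrime ∧ P ≠ ⊥ ∧ s.fin.IsIdempotentIdeal P) {I : Ideal D} (hI : I ≠ ⊥) :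
    s.fin.IsStarProductOf C I ↔
      s.fin.IsIdempotentIdeal I ∧ ∀ P ∈ s.fin.minimalQuasiPrimes I, C P := by
  refine ⟨fun h => ⟨hD.isIdempotentIdeal_of_isStarProductOf (fun P hP => (hC P hP).2) hI h,
    fun P => hD.of_mem_minimalQuasiPrimes_of_isStarProductOf
      (fun P hP => ⟨(hC P hP).1, (hC P hP).2.1⟩) hI h⟩, fun ⟨hidem, h⟩ => ?_⟩
  have hmin := hD.finite_minimalQuasiPrimes hfin hI hidem
  exact isStarProductOf_of_finset (S := hmin.toFinset) (fun P hP => h P (hmin.mem_toFinset.1 hP))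
    (hD.idealCl_eq_idealCl_prod hI hidem hmin.coe_toFinset)

theorem existsUnique_finset_iff (hD : s.IsPruferMultiplicationDomain)
    (hfin : s.fin.HasFiniteCharacter) {C : Ideal D → Prop}
    (hC : ∀ P, C P → s.fin.IsQuasiPrime P ∧ s.fin.IsIdempotentIdeal P) {I : Ideal D}
    (hI : I ≠ ⊥) :
    (∃! S : Finset (Ideal D), (∀ P ∈ S, C P) ∧ IsAntichain (· ≤ ·) (S : Set (Ideal D)) ∧
        s.fin.idealCl I = s.fin.idealCl (∏ P ∈ S, P)) ↔
      s.fin.IsIdempotentIdeal I ∧ ∀ P ∈ s.fin.minimalQuasiPrimes I, C P := by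
  constructor
  · rintro ⟨S, ⟨hS, -, hprod⟩, -⟩
    exact (hD.isStarProductOf_iff hfin
      (fun P hP => ⟨(hC P hP).1.1, (hC P hP).1.2.1, (hC P hP).2⟩) hI).1
      (isStarProductOf_of_finset hS hprod)
  · rintro ⟨hidem, h⟩
    have hmin := hD.finite_minimalQuasiPrimes hfin hI hidem
    refine ⟨hmin.toFinset, ⟨fun P hP => h P (hmin.mem_toFinset.1 hP), ?_,
      hD.idealCl_eq_idealCl_prod hI hidem hmin.coe_toFinset⟩, fun S ⟨hS, hanti, hprod⟩ => ?_⟩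
    · rw [hmin.coe_toFinset]
      exact setOfPred_minimal_antichain _
    · rw [← Finset.coe_inj, hmin.coe_toFinset]
      exact coe_eq_minimalQuasiPrimes hI (fun P hP => (hC P (hS P hP)).1) hanti hprod

end IsPruferMultiplicationDomain

theorem mem_cl_one_div_idealCl_iff {I : Ideal D} (hI : I ≠ ⊥) {z : K} :
    z ∈ s.cl 1 / s.fin.idealCl I ↔ ∀ d ∈ I, z * algebraMap D K d ∈ s.cl 1 := by
  rw [Submodule.mem_div_iff_forall_mul_mem]
  refine ⟨fun h d hd => h _ (algebraMap_mem_idealCl hI hd), fun h y hy => ?_⟩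
  rw [← fin_cl_one] at h ⊢
  refine mul_mem_cl (coeSubmodule_ne_bot hI) one_ne_zero (fun e he => ?_) hy
  obtain ⟨d, hd, rfl⟩ := (IsLocalization.mem_coeSubmodule K I).1 he
  exact h d hd

theorem isFinDivisorial_iff {I : Ideal D} (hI : I ≠ ⊥) :
    s.IsFinDivisorial I ↔
      ∀ x : K, (∀ z : K, (∀ d ∈ I, z * algebraMap D K d ∈ s.cl 1) → x * z ∈ s.cl 1) →
        x ∈ s.fin.idealCl I := by
  have hle : s.fin.idealCl I ≤ s.cl 1 / (s.cl 1 / s.fin.idealCl I) :=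
    Submodule.le_div_iff.2 fun x hx z hz =>
      mul_comm z x ▸ Submodule.mem_div_iff_forall_mul_mem.1 hz x hx
  simp only [← mem_cl_one_div_idealCl_iff hI, ← Submodule.mem_div_iff_forall_mul_mem]
  exact ⟨fun h x hx => h.le hx, fun h => le_antisymm h hle⟩

namespace IsPruferMultiplicationDomain

theorem mem_cl_one_of_forall_mul_mem_cl_one (hD : s.IsPruferMultiplicationDomain) {M : Ideal D}
    (hM : s.fin.IsQuasiMaximal M) (hidem : s.fin.IsIdempotentIdeal M) {z : K}
    (hz : ∀ d ∈ M, z * algebraMap D K d ∈ s.cl 1) : z ∈ s.cl 1 := by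
  obtain ⟨a, b, hb, rfl⟩ := IsFractionRing.div_surjective (A := D) z
  have hb0 := nonZeroDivisors.ne_zero hb
  simp only [div_mul_eq_mul_div, ← map_mul, hD.div_mem_cl_one_iff hb0] at hz ⊢
  intro N _ hN
  simp only [map_mul] at hz
  by_cases hMN : M ≤ N
  · obtain rfl : M = N := le_antisymm hMN (hM.le_of_ge hN.prop hMN)
    have := hD.valuationRing_localization hM
    have hmap := IsLocalization.AtPrime.map_eq_maximalIdeal M (Localization.AtPrime M)
    have hle : maximalIdeal (Localization.AtPrime M) ≤
        (Ideal.span {algebraMap D _ b}).colon {algebraMap D (Localization.AtPrime M) a} :=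
      hmap ▸ Ideal.map_le_iff_le_comap.2 fun d hd => by
        rw [Ideal.mem_comap, Submodule.mem_colon_singleton, smul_eq_mul, mul_comm,
          Ideal.mem_span_singleton]
        exact hz d hd M hM
    refine dvd_of_forall_mem_maximalIdeal_dvd_mul
      (hmap ▸ (hD.isIdempotentIdeal_iff hM.prop.2.1).1 hidem M hM)
      (IsLocalization.to_map_ne_zero_of_mem_nonZeroDivisors _
        M.primeCompl_le_nonZeroDivisors hb) fun x hx => ?_
    exact mul_comm x _ ▸ Ideal.mem_span_singleton.1 (Submodule.mem_colon_singleton.1 (hle hx))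
  · obtain ⟨m, hm, hmN⟩ := SetLike.not_le_iff_exists.1 hMN
    exact (isUnit_algebraMap_atPrime hmN).dvd_mul_right.1 (hz m hm N hN)

theorem not_isQuasiMaximal_of_isFinDivisorial (hD : s.IsPruferMultiplicationDomain)
    (hfin : s.fin.HasFiniteCharacter) {I : Ideal D} (hI : I ≠ ⊥)
    (hidem : s.fin.IsIdempotentIdeal I) (hdiv : s.IsFinDivisorial I) {P : Ideal D}
    (hP : P ∈ s.fin.minimalQuasiPrimes I) : ¬ s.fin.IsQuasiMaximal P := by
  classical
  intro hPmax
  have hmin := hD.finite_minimalQuasiPrimes hfin hI hidem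
  set S := hmin.toFinset
  have hS : ∀ Q ∈ S, Q ∈ s.fin.minimalQuasiPrimes I := fun Q => hmin.mem_toFinset.1
  have hprod : ∏ Q ∈ S, Q ≠ ⊥ := Finset.prod_ne_zero_iff.2 fun Q hQ => (hS Q hQ).1.1.2.1
  have hcl := hD.idealCl_eq_idealCl_prod hI hidem hmin.coe_toFinset
  have hPidem := hD.isIdempotentIdeal_of_mem_minimalQuasiPrimes hI hidem hP
  -- For `z ∈ (D^⋆ : I)` and `j` in the product, `zjP ⊆ zI^⋆ ⊆ D^⋆`, hence `zj ∈ D^⋆`: thus `j` lies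
  -- in the divisorial closure of `I`.
  have herase : ∏ Q ∈ S.erase P, Q ≤ P := by
    refine fun j hj => hP.1.1.2.algebraMap_mem_idealCl_iff.1 (idealCl_mono hI hP.1.2
      ((isFinDivisorial_iff hI).1 hdiv _ fun z hz =>
        hD.mem_cl_one_of_forall_mul_mem_cl_one hPmax hPidem fun p hp => ?_))
    have hpj : algebraMap D K (p * j) ∈ s.fin.idealCl I := by
      refine hcl ▸ algebraMap_mem_idealCl hprod ?_
      rw [← Finset.mul_prod_erase S _ (hmin.mem_toFinset.2 hP)]
      exact Ideal.mul_mem_mul hp hj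
    have hmem := Submodule.mem_div_iff_forall_mul_mem.1
      ((mem_cl_one_div_idealCl_iff hI).2 hz) _ hpj
    rwa [map_mul, mul_left_comm, mul_comm, mul_comm z] at hmem
  obtain ⟨Q, hQ, hQP⟩ := hP.1.1.1.prod_le.1 herase
  have hQmin := hS Q (Finset.mem_of_mem_erase hQ)
  exact Finset.ne_of_mem_erase hQ (eq_of_mem_minimalQuasiPrimes hP hQmin.1.1 hQmin.1.2 hQP)

theorem algebraMap_dvd_of_notMem_of_mem (hD : s.IsPruferMultiplicationDomain) {P M : Ideal D}
    [P.IsPrime] [M.IsPrime] (hM : s.fin.IsQuasiMaximal M) (hPM : P ≤ M) {w p : D} (hw : w ∉ P)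
    (hp : p ∈ P) :
    algebraMap D (Localization.AtPrime M) w ∣ algebraMap D (Localization.AtPrime M) p := by
  refine (hD.algebraMap_dvd_or_dvd hM w p).resolve_right fun h => ?_
  obtain ⟨t, ht, htw⟩ := algebraMap_dvd_algebraMap_atPrime_iff.1 h
  exact (‹P.IsPrime›.mem_or_mem (P.mem_of_dvd htw hp)).elim (fun h => ht (hPM h)) hw

theorem exists_notMem_forall_algebraMap_dvd (hD : s.IsPruferMultiplicationDomain)
    (hfin : s.fin.HasFiniteCharacter) {P M : Ideal D} [P.IsPrime] [M.IsPrime]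
    (hM : s.fin.IsQuasiMaximal M) (hPM : P ≤ M) {w : D} (hw : w ∉ P) :
    ∃ c ∉ M, ∀ (N : Ideal D) [N.IsPrime], s.fin.IsQuasiMaximal N → ¬ P ≤ N →
      algebraMap D (Localization.AtPrime N) w ∣ algebraMap D (Localization.AtPrime N) c := by
  simp only [algebraMap_dvd_algebraMap_atPrime_iff]
  have hlocal : ∀ N : Ideal D, ¬ P ≤ N → ∃ c ∉ M, ∃ t ∉ N, w ∣ t * c := fun N hPN => by
    obtain ⟨p, hp, hpN⟩ := SetLike.not_le_iff_exists.1 hPN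
    obtain ⟨t, ht, htp⟩ := algebraMap_dvd_algebraMap_atPrime_iff.1
      (hD.algebraMap_dvd_of_notMem_of_mem hM hPM hw hp)
    exact ⟨t, ht, p, hpN, mul_comm t p ▸ htp⟩
  choose! c hcM hc using hlocal
  have hwfin : {N | (s.fin.IsQuasiMaximal N ∧ w ∈ N) ∧ ¬ P ≤ N}.Finite :=
    (hfin w fun h => hw (h ▸ P.zero_mem)).subset fun N hN => hN.1
  refine ⟨∏ N ∈ hwfin.toFinset, c N, fun h => ?_, fun N _ hN hPN => ?_⟩
  · obtain ⟨N, hN, hcN⟩ := ‹M.IsPrime›.prod_mem_iff.1 h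
    exact hcM N (hwfin.mem_toFinset.1 hN).2 hcN
  · by_cases hwN : w ∈ N
    · obtain ⟨t, ht, htc⟩ := hc N hPN
      exact ⟨t, ht, htc.trans (mul_dvd_mul_left t
        (Finset.dvd_prod_of_mem c (hwfin.mem_toFinset.2 ⟨⟨hN, hwN⟩, hPN⟩)))⟩
    · exact ⟨w, hwN, dvd_mul_right w _⟩

theorem exists_notMem_forall_div_mul_mem_cl_one (hD : s.IsPruferMultiplicationDomain)
    (hfin : s.fin.HasFiniteCharacter) {P M : Ideal D} [P.IsPrime] [M.IsPrime]
    (hM : s.fin.IsQuasiMaximal M) (hPM : P ≤ M) {w : D} (hw : w ∉ P) :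
    ∃ c ∉ M, ∀ p ∈ P, algebraMap D K c / algebraMap D K w * algebraMap D K p ∈ s.cl 1 := by
  obtain ⟨c, hcM, hc⟩ := hD.exists_notMem_forall_algebraMap_dvd hfin hM hPM hw
  have hw0 : w ≠ 0 := fun h => hw (h ▸ P.zero_mem)
  refine ⟨c, hcM, fun p hp => ?_⟩
  rw [div_mul_eq_mul_div, ← map_mul, hD.div_mem_cl_one_iff hw0]
  intro N _ hN
  rw [map_mul]
  by_cases hPN : P ≤ N
  · exact (hD.algebraMap_dvd_of_notMem_of_mem hN hPN hw hp).mul_left _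
  · exact (hc N hN hPN).mul_right _

theorem mem_of_forall_mul_mem_cl_one (hD : s.IsPruferMultiplicationDomain)
    (hfin : s.fin.HasFiniteCharacter) {P M : Ideal D} [P.IsPrime] [M.IsPrime]
    (hM : s.fin.IsQuasiMaximal M) (hPM : P < M) {x : K}
    (hx : ∀ z : K, (∀ p ∈ P, z * algebraMap D K p ∈ s.cl 1) → x * z ∈ s.cl 1) {t d : D}
    (ht : t ∉ M) (htd : algebraMap D K t * x = algebraMap D K d) : d ∈ P := by
  -- For `m ∈ M ∖ P` some `z = c / (d * m)` with `c ∉ M` multiplies `P` into `D^⋆`, but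
  -- `x * z = c / (t * m)` is not in `D_M`.
  by_contra hd
  obtain ⟨m, hmM, hmP⟩ := SetLike.exists_of_lt hPM
  have hw : d * m ∉ P := fun h => (‹P.IsPrime›.mem_or_mem h).elim hd hmP
  obtain ⟨c, hcM, hc⟩ := hD.exists_notMem_forall_div_mul_mem_cl_one (K := K) hfin hM hPM.le hw
  have ne_zero : ∀ {e : D}, e ≠ 0 → algebraMap D K e ≠ 0 :=
    (map_ne_zero_iff _ (IsFractionRing.injective D K)).2
  have ht0 : t ≠ 0 := fun h => ht (h ▸ M.zero_mem)
  have hm0 : m ≠ 0 := fun h => hmP (h ▸ P.zero_mem)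
  have hd0 : d ≠ 0 := fun h => hd (h ▸ P.zero_mem)
  have hxz : x * (algebraMap D K c / algebraMap D K (d * m)) =
      algebraMap D K c / algebraMap D K (t * m) := by
    rw [mul_div_assoc', div_eq_div_iff (ne_zero (mul_ne_zero hd0 hm0))
      (ne_zero (mul_ne_zero ht0 hm0))]
    simp only [map_mul, ← htd]
    ring
  have hdvd := (hD.div_mem_cl_one_iff (mul_ne_zero ht0 hm0)).1 (hxz ▸ hx _ hc) M hM
  obtain ⟨u, hu, huc⟩ := algebraMap_dvd_algebraMap_atPrime_iff.1 hdvd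
  exact (‹M.IsPrime›.mem_or_mem (M.mem_of_dvd huc (M.mul_mem_left t hmM))).elim hu hcM

theorem isFinDivisorial_of_forall_not_isQuasiMaximal (hD : s.IsPruferMultiplicationDomain)
    (hfin : s.fin.HasFiniteCharacter) {I : Ideal D} (hI : I ≠ ⊥)
    (hidem : s.fin.IsIdempotentIdeal I)
    (h : ∀ P ∈ s.fin.minimalQuasiPrimes I, ¬ s.fin.IsQuasiMaximal P) : s.IsFinDivisorial I := by
  refine (isFinDivisorial_iff hI).2 fun x hx => ?_
  have hone : ∀ d : D, algebraMap D K d ∈ s.cl 1 := fun d =>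
    s.le_cl 1 one_ne_zero (Submodule.mem_one.2 ⟨d, rfl⟩)
  have hx1 : x ∈ s.fin.cl 1 := by
    rw [fin_cl_one, ← mul_one x]
    exact hx 1 fun d _ => (one_mul (algebraMap D K d)).symm ▸ hone d
  refine (hD.mem_fin_cl_iff (coeSubmodule_ne_bot hI)).2 fun M hM => ?_
  have := hM.isPrime
  obtain ⟨t, ht, htx⟩ := (hD.mem_fin_cl_iff one_ne_zero).1 hx1 M hM
  obtain ⟨d, hd⟩ := Submodule.mem_one.1 htx
  suffices hmem : ∃ u ∉ M, u * d ∈ I by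
    obtain ⟨u, hu, hud⟩ := hmem
    refine ⟨u * t, M.primeCompl.mul_mem hu ht, ?_⟩
    rw [mul_smul, ← hd, Algebra.smul_def, ← map_mul]
    exact algebraMap_mem_coeSubmodule.2 hud
  by_cases hIM : I ≤ M
  · rw [← algebraMap_mem_map_atPrime_iff, ← Ideal.mem_comap, ← Ideal.under_def]
    set P := (I.map (algebraMap D (Localization.AtPrime M))).under D with hP
    have hPM : P ≤ M := under_map_atPrime_le hIM le_rfl
    have hPmin := (hD.mem_minimalQuasiPrimes_iff hI hidem hM hIM hPM).2 hP
    have := hPmin.1.1.1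
    refine hD.mem_of_forall_mul_mem_cl_one hfin hM
      (hPM.lt_of_ne fun hPM => h P hPmin (hPM ▸ hM))
      (fun z hz => hx z fun d hd => hz d (hPmin.1.2 hd)) ht ?_
    rw [hd, Algebra.smul_def]
  · obtain ⟨i, hi, hiM⟩ := SetLike.not_le_iff_exists.1 hIM
    exact ⟨i, hiM, I.mul_mem_right d hi⟩

theorem isFinDivisorial_iff_forall_not_isQuasiMaximal (hD : s.IsPruferMultiplicationDomain)
    (hfin : s.fin.HasFiniteCharacter) {I : Ideal D} (hI : I ≠ ⊥)
    (hidem : s.fin.IsIdempotentIdeal I) :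
    s.IsFinDivisorial I ↔ ∀ P ∈ s.fin.minimalQuasiPrimes I, ¬ s.fin.IsQuasiMaximal P :=
  ⟨fun hdiv _ => hD.not_isQuasiMaximal_of_isFinDivisorial hfin hI hidem hdiv,
    hD.isFinDivisorial_of_forall_not_isQuasiMaximal hfin hI hidem⟩

end IsPruferMultiplicationDomain

theorem IsQuasiPrime.minimalQuasiPrimes_eq_singleton {P : Ideal D} (hP : s.IsQuasiPrime P) :
    s.minimalQuasiPrimes P = {P} :=
  Set.eq_singleton_iff_unique_mem.2 ⟨⟨⟨hP, le_rfl⟩, fun _ hQ _ => hQ.2⟩,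
    fun _ hQ => (eq_of_mem_minimalQuasiPrimes hQ hP le_rfl hQ.1.2).symm⟩

theorem IsPruferMultiplicationDomain.isFinDivisorial_iff_not_isQuasiMaximal
    (hD : s.IsPruferMultiplicationDomain) (hfin : s.fin.HasFiniteCharacter) {P : Ideal D}
    (hP : s.fin.IsQuasiPrime P) (hidem : s.fin.IsIdempotentIdeal P) :
    s.IsFinDivisorial P ↔ ¬ s.fin.IsQuasiMaximal P := by
  rw [hD.isFinDivisorial_iff_forall_not_isQuasiMaximal hfin hP.2.1 hidem,
    hP.minimalQuasiPrimes_eq_singleton]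
  simp only [Set.mem_singleton_iff, forall_eq]

end SemistarOperation

theorem mainTheorem4_general {D K : Type*} [CommRing D] [IsDomain D] [Field K] [Algebra D K]
    [IsFractionRing D K] (s : SemistarOperation D K)
    (hD : s.IsPruferMultiplicationDomain) (hfin : s.fin.HasFiniteCharacter)
    (I : Ideal D) (hI : I ≠ ⊥) :
    (s.fin.IsIdempotentIdeal I ↔
      s.fin.IsStarProductOf (fun P => s.fin.IsQuasiPrime P ∧ s.fin.IsIdempotentIdeal P) I) ∧
    List.TFAE [
      s.fin.IsIdempotentIdeal I ∧ s.IsFinDivisorial I,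
      s.fin.IsStarProductOf (fun P => s.fin.IsQuasiPrime P ∧ ¬ s.fin.IsQuasiMaximal P ∧
        s.fin.IsIdempotentIdeal P) I,
      s.fin.IsStarProductOf (fun P => P.IsPrime ∧ P ≠ ⊥ ∧ s.IsFinDivisorial P ∧
        s.fin.IsIdempotentIdeal P) I,
      ∃! S : Finset (Ideal D),
        (∀ P ∈ S, s.fin.IsQuasiPrime P ∧ s.IsFinDivisorial P ∧ s.fin.IsIdempotentIdeal P) ∧
        IsAntichain (· ≤ ·) (S : Set (Ideal D)) ∧
        s.fin.idealCl I = s.fin.idealCl (∏ P ∈ S, P)] := by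
  have hmin (hidem : s.fin.IsIdempotentIdeal I) {P : Ideal D}
      (hP : P ∈ s.fin.minimalQuasiPrimes I) :
      s.fin.IsQuasiPrime P ∧ s.fin.IsIdempotentIdeal P :=
    ⟨hP.1.1, hD.isIdempotentIdeal_of_mem_minimalQuasiPrimes hI hidem hP⟩
  have hdiv (hidem : s.fin.IsIdempotentIdeal I) {P : Ideal D}
      (hP : P ∈ s.fin.minimalQuasiPrimes I) : s.IsFinDivisorial P ↔ ¬ s.fin.IsQuasiMaximal P :=
    hD.isFinDivisorial_iff_not_isQuasiMaximal hfin (hmin hidem hP).1 (hmin hidem hP).2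
  rw [hD.isStarProductOf_iff hfin (fun P hP => ⟨hP.1.1, hP.1.2.1, hP.2⟩) hI,
    hD.isStarProductOf_iff hfin (fun P hP => ⟨hP.1.1, hP.1.2.1, hP.2.2⟩) hI,
    hD.isStarProductOf_iff hfin (fun P hP => ⟨hP.1, hP.2.1, hP.2.2.2⟩) hI,
    hD.existsUnique_finset_iff hfin (fun P hP => ⟨hP.1, hP.2.2⟩) hI]
  refine ⟨⟨fun h => ⟨h, fun P => hmin h⟩, And.left⟩, ?_⟩
  tfae_have 1 ↔ 2 := and_congr_right fun hidem => by
    rw [hD.isFinDivisorial_iff_forall_not_isQuasiMaximal hfin hI hidem]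
    exact forall₂_congr fun P hP => by simp [hmin hidem hP]
  tfae_have 2 ↔ 3 := and_congr_right fun hidem => forall₂_congr fun P hP => by
    simp [hmin hidem hP, hdiv hidem hP, (hmin hidem hP).1.1, (hmin hidem hP).1.2.1]
  tfae_have 2 ↔ 4 := and_congr_right fun hidem => forall₂_congr fun P hP => by
    simp only [hdiv hidem hP]
  tfae_finish

theorem mainTheorem4 {D K : Type*} [CommRing D] [IsDomain D] [Field K] [Algebra D K]
    [IsFractionRing D K] (s : SemistarOperation D K)
    (hD : s.IsPruferMultiplicationDomain) (hfin : s.fin.HasFiniteCharacter)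
    (I : Ideal D) (hI : s.fin.IsQuasiIdeal I) :
    (s.fin.IsIdempotentIdeal I ↔
      s.fin.IsStarProductOf (fun P => s.fin.IsQuasiPrime P ∧ s.fin.IsIdempotentIdeal P) I) ∧
    List.TFAE [
      s.fin.IsIdempotentIdeal I ∧ s.IsFinDivisorial I,
      s.fin.IsStarProductOf (fun P => s.fin.IsQuasiPrime P ∧ ¬ s.fin.IsQuasiMaximal P ∧
        s.fin.IsIdempotentIdeal P) I,
      s.fin.IsStarProductOf (fun P => P.IsPrime ∧ P ≠ ⊥ ∧ s.IsFinDivisorial P ∧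
        s.fin.IsIdempotentIdeal P) I,
      ∃! S : Finset (Ideal D),
        (∀ P ∈ S, s.fin.IsQuasiPrime P ∧ s.IsFinDivisorial P ∧ s.fin.IsIdempotentIdeal P) ∧
        IsAntichain (· ≤ ·) (S : Set (Ideal D)) ∧
        s.fin.idealCl I = s.fin.idealCl (∏ P ∈ S, P)] :=
  mainTheorem4_general s hD hfin I hI.1
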